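/- Let $\mathcal{C}$ be a semi-abelian category, that is, a category which has a zero object, is exact in the sense of Barr (it is regular and every internal equivalence relation is a kernel pair), is protomodular in the sense of Bourn (for every morphism $p\colon E\to B$ the change-of-base functor $p^*\colon \mathrm{Pt}_B(\mathcal{C})\to \mathrm{Pt}_E(\mathcal{C})$ of the fibration of points, i.e. of split epimorphisms with a chosen section, reflects isomorphisms), and has binary coproducts. A normal monomorphism is a kernel of some morphism. Then the following conditions are equivalent: (i) $\mathcal{C}$ satisfies transitivity of normality (ToN): any composite of two normal monomorphisms of $\mathcal{C}$ is again a normal monomorphism; (ii) any pushout of a normal monomorphism along a regular epimorphism is a monomorphism: for every pushout square $$\begin{array}{ccc} A & \xrightarrow{\;e\;} & B\\ {\scriptstyle n}\downarrow & & \downarrow{\scriptstyle n'}\\ A' & \xrightarrow{\;e'\;} & P\end{array}$$ in $\mathcal{C}$ with $n$ a normal monomorphism and $e$ a regular epimorphism, $n'$ is a monomorphism. Moreover, in every semi-abelian category (whether or not (i) and (ii) hold), if in such a pushout square, with $n$ a normal monomorphism and $e$ a regular epimorphism, $n'$ is a monomorphism, then $n'$ is necessarily a normal monomorphism. -/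

import Mathlib

open CategoryTheory CategoryTheory.Limits

namespace SemiAbelian

universe v u

section Relations

variable {C : Type u} [Category.{v} C]

/-- The pair `r₁ r₂ : R ⟶ X` is an internal equivalence relation on `X`: it is jointly monic,
reflexive, symmetric and transitive. Transitivity is expressed on generalised elements; when the
pullback of `r₂` along `r₁` exists, it amounts to the existence of an internal composition. -/
structure IsEquivalenceRelation {R X : C} (r₁ r₂ : R ⟶ X) : Prop where
  jointly_mono : ∀ {T : C} (a b : T ⟶ R), a ≫ r₁ = b ≫ r₁ → a ≫ r₂ = b ≫ r₂ → a = b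
  refl : ∃ s : X ⟶ R, s ≫ r₁ = 𝟙 X ∧ s ≫ r₂ = 𝟙 X
  symm : ∃ t : R ⟶ R, t ≫ r₁ = r₂ ∧ t ≫ r₂ = r₁
  trans : ∀ {T : C} (a b : T ⟶ R), a ≫ r₂ = b ≫ r₁ →
    ∃ c : T ⟶ R, c ≫ r₁ = a ≫ r₁ ∧ c ≫ r₂ = b ≫ r₂

variable (C)

/-- Exactness in the sense of Barr: the category is regular, and every internal equivalence
relation is effective, that is, it is the kernel pair of some morphism. -/
class IsBarrExact : Prop where
  regular : Regular C
  effective : ∀ {R X : C} (r₁ r₂ : R ⟶ X), IsEquivalenceRelation r₁ r₂ →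
    ∃ (Y : C) (q : X ⟶ Y), IsKernelPair q r₁ r₂

end Relations

section Points

variable {C : Type u} [Category.{v} C]

/-- A point over `B`: a split epimorphism `π : A ⟶ B` with a chosen section `σ`. -/
structure Pt (B : C) where
  A : C
  π : A ⟶ B
  σ : B ⟶ A
  σ_π : σ ≫ π = 𝟙 B

/-- A morphism of points over `B`: it commutes with the split epimorphisms and the sections. -/
@[ext]
structure PtHom {B : C} (P Q : Pt B) where
  hom : P.A ⟶ Q.A
  hom_π : hom ≫ Q.π = P.π
  σ_hom : P.σ ≫ hom = Q.σ

/-- The category of points over `B`. -/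
instance instCategoryPt (B : C) : Category (Pt B) where
  Hom P Q := PtHom P Q
  id P := ⟨𝟙 P.A, Category.id_comp _, Category.comp_id _⟩
  comp f g := ⟨f.hom ≫ g.hom, by rw [Category.assoc, g.hom_π, f.hom_π],
    by rw [← Category.assoc, f.σ_hom, g.σ_hom]⟩
  id_comp f := PtHom.ext (Category.id_comp _)
  comp_id f := PtHom.ext (Category.comp_id _)
  assoc f g h := PtHom.ext (Category.assoc _ _ _)

@[ext]
theorem Pt.hom_ext {B : C} {P Q : Pt B} {f g : P ⟶ Q} (h : f.hom = g.hom) : f = g :=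
  PtHom.ext h

@[simp]
theorem Pt.id_hom {B : C} (P : Pt B) : PtHom.hom (𝟙 P) = 𝟙 P.A := rfl

@[simp]
theorem Pt.comp_hom {B : C} {P Q R : Pt B} (f : P ⟶ Q) (g : Q ⟶ R) :
    PtHom.hom (f ≫ g) = f.hom ≫ g.hom := rfl

section ChangeOfBase

variable {E B : C} (p : E ⟶ B)

theorem changeOfBase_obj_w (P : Pt B) : (p ≫ P.σ) ≫ P.π = 𝟙 E ≫ p := by
  simp [P.σ_π]

variable [HasPullbacks C]

theorem changeOfBase_map_w {P Q : Pt B} (f : P ⟶ Q) :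
    (pullback.fst P.π p ≫ f.hom) ≫ Q.π = pullback.snd P.π p ≫ p :=
  (Category.assoc _ _ _).trans ((congrArg _ f.hom_π).trans pullback.condition)

theorem changeOfBase_map_σ {P Q : Pt B} (f : P ⟶ Q) :
    pullback.lift (p ≫ P.σ) (𝟙 E) (changeOfBase_obj_w p P) ≫
      pullback.lift (pullback.fst P.π p ≫ f.hom) (pullback.snd P.π p) (changeOfBase_map_w p f) =
    pullback.lift (p ≫ Q.σ) (𝟙 E) (changeOfBase_obj_w p Q) := by
  apply pullback.hom_ext <;>
    simp [f.σ_hom, pullback.lift_fst, pullback.lift_snd, pullback.lift_fst_assoc]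

theorem changeOfBase_map_id (P : Pt B) :
    pullback.lift (pullback.fst P.π p ≫ PtHom.hom (𝟙 P)) (pullback.snd P.π p)
      (changeOfBase_map_w p (𝟙 P)) = 𝟙 _ := by
  apply pullback.hom_ext <;> simp

theorem changeOfBase_map_comp {P Q R : Pt B} (f : P ⟶ Q) (g : Q ⟶ R) :
    pullback.lift (pullback.fst P.π p ≫ PtHom.hom (f ≫ g)) (pullback.snd P.π p)
      (changeOfBase_map_w p (f ≫ g)) =
    pullback.lift (pullback.fst P.π p ≫ f.hom) (pullback.snd P.π p) (changeOfBase_map_w p f) ≫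
      pullback.lift (pullback.fst Q.π p ≫ g.hom) (pullback.snd Q.π p)
        (changeOfBase_map_w p g) := by
  apply pullback.hom_ext <;>
    simp [pullback.lift_fst, pullback.lift_snd, pullback.lift_fst_assoc]

/-- The change-of-base functor along `p : E ⟶ B` of the fibration of points: it sends a point
`(A, π, σ)` over `B` to the pullback of `π` along `p`, with the section induced by `σ`, and a
morphism of points to the induced morphism between the pullbacks. -/
noncomputable def changeOfBase : Pt B ⥤ Pt E where
  obj P :=
    { A := pullback P.π p
      π := pullback.snd P.π p
      σ := pullback.lift (p ≫ P.σ) (𝟙 E) (changeOfBase_obj_w p P)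
      σ_π := pullback.lift_snd _ _ _ }
  map {P _} f :=
    { hom := pullback.lift (pullback.fst P.π p ≫ f.hom) (pullback.snd P.π p)
        (changeOfBase_map_w p f)
      hom_π := pullback.lift_snd _ _ _
      σ_hom := changeOfBase_map_σ p f }
  map_id P := Pt.hom_ext (changeOfBase_map_id p P)
  map_comp f g := Pt.hom_ext (changeOfBase_map_comp p f g)

end ChangeOfBase

variable (C)

/-- Protomodularity in the sense of Bourn: every change-of-base functor of the fibration of points
reflects isomorphisms. -/
class IsProtomodular [HasPullbacks C] : Prop where
  reflects : ∀ {E B : C} (p : E ⟶ B), (changeOfBase p).ReflectsIsomorphisms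

end Points

section SemiAbelianCategories

variable (C : Type u) [Category.{v} C]

/-- A category is semi-abelian when it is pointed (it has a zero object), Barr exact, Bourn
protomodular, and has binary coproducts. -/
class IsSemiAbelian : Prop where
  hasZeroObject : HasZeroObject C
  barrExact : IsBarrExact C
  protomodular : haveI : Regular C := barrExact.regular; IsProtomodular C
  hasBinaryCoproducts : HasBinaryCoproducts C

variable {C} in
/-- A morphism is a normal monomorphism when it is a kernel of some morphism. -/
def IsNormalMono [HasZeroMorphisms C] {X Y : C} (f : X ⟶ Y) : Prop :=
  Nonempty (NormalMono f)

/-- Transitivity of normality (ToN): any composite of two normal monomorphisms is a normal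
monomorphism. -/
def ToN [HasZeroMorphisms C] : Prop :=
  ∀ {X Y Z : C} (f : X ⟶ Y) (g : Y ⟶ Z), IsNormalMono f → IsNormalMono g → IsNormalMono (f ≫ g)

end SemiAbelianCategories

end SemiAbelian

/-! Protomodularity gives `isIso_of_mono_of_section_of_kernel`, from which follow the homological
lemmas and the Mal'tsev property, so that reflexive relations are kernel pairs. (i) ⇒ (ii): by ToN,
`kernel.ι e ≫ n` is the kernel of some `k`, and `n ≫ k` factors through `e`, so `k` factors through
the pushout. What `n'` kills thus comes, up to a cover, from the kernel of `e`, so it is zero. (ii)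
⇒ (i): for normal `f : X ⟶ Y`, `g : Y ⟶ Z`, pushing `g` out along `Y ⟶ Y/X` gives the cokernel of `f
≫ g`. As `Y/X ⟶ P` is mono, the kernel of `Z ⟶ P` is `X`. Normality of `n'`: the image along `e'` of
the kernel pair defining `n` is an effective equivalence relation, with zero class `n'`. -/

namespace SemiAbelian

attribute [local simp] pullback.lift_fst pullback.lift_snd pullback.lift_fst_assoc
  pullback.lift_snd_assoc prod.lift_fst prod.lift_snd prod.lift_fst_assoc prod.lift_snd_assoc
  coprod.inl_desc coprod.inr_desc coprod.inl_desc_assoc coprod.inr_desc_assoc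

/-- Pushouts of regular epimorphisms are regular epimorphisms. -/
theorem isRegularEpi_of_isPushout {C : Type*} [Category C] {A A' B P : C} {n : A ⟶ A'} {e : A ⟶ B}
    {e' : A' ⟶ P} {n' : B ⟶ P} [IsRegularEpi e] (sq : IsPushout n e e' n') : IsRegularEpi e' := by
  have hd {W : C} (u : A' ⟶ W) (hu : (IsRegularEpi.left e ≫ n) ≫ u =
      (IsRegularEpi.right e ≫ n) ≫ u) : n ≫ u = e ≫ IsRegularEpi.desc e (n ≫ u) (by
        simpa using hu) := (IsRegularEpi.fac e _ _).symm
  exact ⟨⟨_, IsRegularEpi.left e ≫ n, IsRegularEpi.right e ≫ n, by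
    rw [Category.assoc, Category.assoc, sq.w, ← Category.assoc, IsRegularEpi.w e, Category.assoc],
    Cofork.IsColimit.mk _ (fun s => sq.desc s.π _ (hd s.π s.condition))
      (fun s => sq.inl_desc _ _ _) (fun s m hm => by
        have hm : e' ≫ m = s.π := hm
        apply sq.hom_ext
        · rw [hm, sq.inl_desc]
        · rw [sq.inr_desc, ← cancel_epi e, ← hd s.π s.condition, ← hm, sq.w_assoc])⟩⟩

/-! ### Homological lemmas and the Mal'tsev property -/

section Protomodular

variable {C : Type*} [Category C] [Regular C] [HasZeroMorphisms C] [HasZeroObject C]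
  [IsProtomodular C]

open scoped ZeroObject

/-- In a pointed protomodular category, the kernel and the section of a split epimorphism are
jointly extremal-epic. -/
theorem isIso_of_mono_of_section_of_kernel {E B M : C} {p : E ⟶ B} {s : B ⟶ E} (hs : s ≫ p = 𝟙 B)
    (m : M ⟶ E) [Mono m] (s' : B ⟶ M) (hs' : s' ≫ m = s)
    (hk : ∀ {T : C} (t : T ⟶ E), t ≫ p = 0 → ∃ u : T ⟶ M, u ≫ m = t) : IsIso m := by
  let P : Pt B := ⟨M, m ≫ p, s', by rw [← Category.assoc, hs', hs]⟩
  let Q : Pt B := ⟨E, p, s, hs⟩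
  let f : P ⟶ Q := ⟨m, rfl, hs'⟩
  -- Change of base along `0 ⟶ B` sends a point to its kernel.
  let z : (0 : C) ⟶ B := 0
  obtain ⟨u, hu⟩ := hk (pullback.fst Q.π z) (by
    change pullback.fst Q.π z ≫ Q.π = 0
    rw [pullback.condition, comp_zero])
  have hQP : ∃ g : (changeOfBase z).obj Q ⟶ (changeOfBase z).obj P,
      (changeOfBase z).map f ≫ g = 𝟙 _ ∧ g ≫ (changeOfBase z).map f = 𝟙 _ := by
    have hw : u ≫ P.π = pullback.snd Q.π z ≫ z := by
      change u ≫ m ≫ p = _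
      rw [← Category.assoc, hu]
      exact pullback.condition
    refine ⟨⟨pullback.lift u (pullback.snd Q.π z) hw, pullback.lift_snd _ _ _, ?_⟩, ?_, ?_⟩
    · exact (isZero_zero C).eq_of_src _ _
    · apply Pt.hom_ext
      apply pullback.hom_ext
      · rw [← cancel_mono m]
        simp only [Pt.comp_hom, Category.assoc, Pt.id_hom, changeOfBase]
        rw [pullback.lift_fst_assoc, hu, pullback.lift_fst]
        exact (Category.id_comp _).symm
      · exact (isZero_zero C).eq_of_tgt _ _
    · apply Pt.hom_ext
      apply pullback.hom_ext
      · simp only [Pt.comp_hom, Category.assoc, Pt.id_hom, changeOfBase]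
        rw [pullback.lift_fst, pullback.lift_fst_assoc]
        exact hu.trans (Category.id_comp _).symm
      · exact (isZero_zero C).eq_of_tgt _ _
  have : IsIso ((changeOfBase z).map f) := ⟨hQP⟩
  have := (IsProtomodular.reflects z).reflects f
  obtain ⟨g, h₁, h₂⟩ := this.out
  exact ⟨g.hom, congrArg PtHom.hom h₁, congrArg PtHom.hom h₂⟩

/-- A morphism with trivial kernel is a monomorphism. -/
theorem mono_of_cancel_zero' {X Y : C} (f : X ⟶ Y)
    (hf : ∀ {T : C} (t : T ⟶ X), t ≫ f = 0 → t = 0) : Mono f := by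
  have : IsIso (pullback.diagonal f) :=
    isIso_of_mono_of_section_of_kernel (pullback.diagonal_fst f) _ (𝟙 X) (Category.id_comp _)
      fun t ht => ⟨0, by
        have h : t ≫ pullback.snd f f = 0 := hf _ (by
          rw [Category.assoc, ← pullback.condition, ← Category.assoc, ht, zero_comp])
        apply pullback.hom_ext <;> simp [h, ht]⟩
  refine (IsKernelPair.of_hasPullback f).mono_of_eq_fst_snd ?_
  rw [← cancel_epi (pullback.diagonal f)]
  simp

/-- A regular epimorphism is a cokernel of its kernel. -/
theorem exists_desc_of_isRegularEpi {X Y Z : C} (f : X ⟶ Y) [IsRegularEpi f] (g : X ⟶ Z)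
    (hg : ∀ {T : C} (t : T ⟶ X), t ≫ f = 0 → t ≫ g = 0) : ∃ h : Y ⟶ Z, f ≫ h = g := by
  refine IsRegularEpi.exists_of_isKernelPair f (IsKernelPair.of_hasPullback f) g ?_
  -- The equalizer contains the diagonal and the kernel of the first projection.
  have : IsIso (equalizer.ι (pullback.fst f f ≫ g) (pullback.snd f f ≫ g)) :=
    isIso_of_mono_of_section_of_kernel (pullback.diagonal_fst f) _
      (equalizer.lift (pullback.diagonal f) (by simp)) (equalizer.lift_ι _ _)
      fun t ht => ⟨equalizer.lift t (by
        have h : t ≫ pullback.snd f f ≫ g = 0 := by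
          rw [← Category.assoc]
          exact hg _ (by rw [Category.assoc, ← pullback.condition, reassoc_of% ht, zero_comp])
        rw [h, reassoc_of% ht, zero_comp]), equalizer.lift_ι _ _⟩
  rw [← cancel_epi (equalizer.ι (pullback.fst f f ≫ g) (pullback.snd f f ≫ g))]
  exact equalizer.condition _ _

/-- A form of the short five lemma. -/
theorem isIso_of_mono_of_kernel {I T S : C} (i : I ⟶ T) [Mono i] (p : T ⟶ S)
    [IsRegularEpi (i ≫ p)] (hk : ∀ {W : C} (t : W ⟶ T), t ≫ p = 0 → ∃ u : W ⟶ I, u ≫ i = t) :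
    IsIso i := by
  let q := i ≫ p
  -- Pulling back along `q` makes `p` split, reducing to the split case.
  let m : pullback q q ⟶ pullback q p :=
    pullback.lift (pullback.fst q q) (pullback.snd q q ≫ i) (by
      rw [Category.assoc]; exact pullback.condition)
  have hm₁ : m ≫ pullback.fst q p = pullback.fst q q := pullback.lift_fst _ _ _
  have hm₂ : m ≫ pullback.snd q p = pullback.snd q q ≫ i := pullback.lift_snd _ _ _
  have : Mono m := ⟨fun a b h => by
    apply pullback.hom_ext
    · rw [← hm₁, reassoc_of% h]
    · rw [← cancel_mono i, Category.assoc, Category.assoc, ← hm₂, reassoc_of% h]⟩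
  have : IsIso m := isIso_of_mono_of_section_of_kernel
    (p := pullback.fst q p) (s := pullback.lift (𝟙 I) i (Category.id_comp _))
    (pullback.lift_fst _ _ _) m (pullback.diagonal q)
    (by apply pullback.hom_ext <;> simp [hm₁, hm₂])
    fun t ht => by
      have h : t ≫ pullback.snd q p ≫ p = 0 := by
        rw [← pullback.condition, reassoc_of% ht, zero_comp]
      obtain ⟨u, hu⟩ := hk (t ≫ pullback.snd q p) (by rw [Category.assoc, h])
      refine ⟨pullback.lift 0 u (by rw [zero_comp, ← Category.assoc, hu, Category.assoc, h]), ?_⟩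
      apply pullback.hom_ext <;> simp [hm₁, hm₂, ht, hu]
  have : IsRegularEpi q := ‹IsRegularEpi (i ≫ p)›
  exact ExtremalEpi.isIso (pullback.snd q p) (inv m ≫ pullback.snd q q) i (by
    rw [Category.assoc, ← hm₂, IsIso.inv_hom_id_assoc])

/-- A commutative square of split epimorphisms and regular epimorphisms is a regular pushout. -/
theorem isRegularEpi_pullback_lift {R S A P : C} (φ : R ⟶ S) (f : A ⟶ P) [IsRegularEpi φ]
    (r : R ⟶ A) (σ : A ⟶ R) (hσ : σ ≫ r = 𝟙 A) (s : S ⟶ P) (τ : P ⟶ S)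
    (w : r ≫ f = φ ≫ s) (hτ : σ ≫ φ = f ≫ τ) : IsRegularEpi (pullback.lift r φ w) := by
  have : ExtremalEpi (pullback.lift r φ w) := ExtremalEpi.mk_of_hasEqualizers _ fun I d i hd _ => by
    have hφ : d ≫ i ≫ pullback.snd f s = φ := by
      rw [← Category.assoc, hd, pullback.lift_snd]
    have : ExtremalEpi (i ≫ pullback.snd f s) := by
      rw [extremalEpi_iff_strongEpi_of_hasPullbacks]
      have : StrongEpi (d ≫ i ≫ pullback.snd f s) := by rw [hφ]; infer_instance
      exact strongEpi_of_strongEpi d _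
    refine isIso_of_mono_of_kernel i (pullback.snd f s) fun t ht => ?_
    -- `σ ≫ φ = f ≫ τ` vanishes on the first component of `t`, which `f` kills.
    refine ⟨t ≫ pullback.fst f s ≫ σ ≫ d, ?_⟩
    have h : t ≫ pullback.fst f s ≫ f = 0 := by
      rw [pullback.condition, reassoc_of% ht, zero_comp]
    simp only [Category.assoc, hd]
    apply pullback.hom_ext
    · simp [hσ]
    · simp [hτ, ht, reassoc_of% h]
  infer_instance

/-- Protomodular categories are Mal'tsev: every relation is difunctional. -/
theorem exists_of_jointlyMono {R X Y : C} (r₁ : R ⟶ X) (r₂ : R ⟶ Y)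
    (hr : ∀ {T : C} (a b : T ⟶ R), a ≫ r₁ = b ≫ r₁ → a ≫ r₂ = b ≫ r₂ → a = b)
    {T : C} (a b c : T ⟶ R) (hab : a ≫ r₂ = b ≫ r₂) (hbc : b ≫ r₁ = c ≫ r₁) :
    ∃ d : T ⟶ R, d ≫ r₁ = a ≫ r₁ ∧ d ≫ r₂ = c ≫ r₂ := by
  let B := pullback r₂ r₂
  let a' : B ⟶ R := pullback.fst r₂ r₂
  let b' : B ⟶ R := pullback.snd r₂ r₂
  have hab' : a' ≫ r₂ = b' ≫ r₂ := pullback.condition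
  let W := pullback (b' ≫ r₁) r₁
  let p : W ⟶ B := pullback.fst (b' ≫ r₁) r₁
  let c' : W ⟶ R := pullback.snd (b' ≫ r₁) r₁
  have hW : p ≫ b' ≫ r₁ = c' ≫ r₁ := pullback.condition
  let s : B ⟶ W := pullback.lift (𝟙 B) b' (Category.id_comp _)
  have hsp : s ≫ p = 𝟙 B := pullback.lift_fst _ _ _
  have hsc : s ≫ c' = b' := pullback.lift_snd _ _ _
  let ρ : R ⟶ X ⨯ Y := prod.lift r₁ r₂
  have : Mono ρ := ⟨fun x y h => hr x y
    (by simpa [ρ] using h =≫ prod.fst) (by simpa [ρ] using h =≫ prod.snd)⟩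
  let ω : W ⟶ X ⨯ Y := prod.lift (p ≫ a' ≫ r₁) (c' ≫ r₂)
  -- `W` is the universal zigzag `(a, b, c)`. The required element of `R` is `a` on the section `c =
  -- b`, and `c` on the kernel `a = b = 0`.
  have : IsIso (pullback.fst ω ρ) := isIso_of_mono_of_section_of_kernel hsp _
    (pullback.lift s a' (by
      apply Limits.prod.hom_ext
      · simp [ω, ρ, reassoc_of% hsp]
      · simp [ω, ρ, reassoc_of% hsc, hab']))
    (pullback.lift_fst _ _ _)
    fun t ht => ⟨pullback.lift t (t ≫ c') (by
      apply Limits.prod.hom_ext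
      · simp [ω, ρ, ← hW, reassoc_of% ht]
      · simp [ω, ρ]), pullback.lift_fst _ _ _⟩
  have hd := pullback.condition (f := ω) (g := ρ)
  let t : T ⟶ W := pullback.lift (pullback.lift a b hab) c (by
    simp only [b', ← Category.assoc]; rw [pullback.lift_snd, hbc])
  have hta : t ≫ p ≫ a' = a := by
    simp only [t, p, a']; rw [pullback.lift_fst_assoc, pullback.lift_fst]
  have htc : t ≫ c' = c := pullback.lift_snd _ _ _
  have hd₁ : pullback.snd ω ρ ≫ r₁ = pullback.fst ω ρ ≫ p ≫ a' ≫ r₁ := by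
    simpa [ω, ρ] using (hd =≫ prod.fst).symm
  have hd₂ : pullback.snd ω ρ ≫ r₂ = pullback.fst ω ρ ≫ c' ≫ r₂ := by
    simpa [ω, ρ] using (hd =≫ prod.snd).symm
  refine ⟨t ≫ inv (pullback.fst ω ρ) ≫ pullback.snd ω ρ, ?_, ?_⟩
  · simp [hd₁, reassoc_of% hta]
  · simp [hd₂, reassoc_of% htc]

/-- In a pointed protomodular category, every reflexive relation is an equivalence relation. -/
theorem IsEquivalenceRelation.of_refl {R X : C} (r₁ r₂ : R ⟶ X)
    (hr : ∀ {T : C} (a b : T ⟶ R), a ≫ r₁ = b ≫ r₁ → a ≫ r₂ = b ≫ r₂ → a = b)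
    (s : X ⟶ R) (hs₁ : s ≫ r₁ = 𝟙 X) (hs₂ : s ≫ r₂ = 𝟙 X) : IsEquivalenceRelation r₁ r₂ where
  jointly_mono := hr
  refl := ⟨s, hs₁, hs₂⟩
  symm := by
    -- The zigzag `(y, y)`, `(x, y)`, `(x, x)` yields `(y, x)`.
    obtain ⟨t, h₁, h₂⟩ := exists_of_jointlyMono r₁ r₂ hr (r₂ ≫ s) (𝟙 R) (r₁ ≫ s)
      (by simp [hs₂]) (by simp [hs₁])
    exact ⟨t, by simpa [hs₁] using h₁, by simpa [hs₂] using h₂⟩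
  trans a b hab := by
    obtain ⟨c, h₁, h₂⟩ := exists_of_jointlyMono r₁ r₂ hr a (b ≫ r₁ ≫ s) b
      (by simp [hs₂, hab]) (by simp [hs₁])
    exact ⟨c, h₁, h₂⟩

/-- If normality is transitive, then pushouts of normal monomorphisms along regular epimorphisms
are monomorphisms. -/
theorem ToN.mono_of_isPushout (H : ToN C) {A A' B P : C} {n : A ⟶ A'} {e : A ⟶ B} {e' : A' ⟶ P}
    {n' : B ⟶ P} (hn : IsNormalMono n) [IsRegularEpi e] (sq : IsPushout n e e' n') : Mono n' := by
  have : Mono n := by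
    obtain ⟨hn⟩ := hn
    infer_instance
  obtain ⟨hkn⟩ := H (kernel.ι e) n
    ⟨⟨B, e, kernel.condition e, kernelIsKernel e⟩⟩ hn
  obtain ⟨v, hv⟩ := exists_desc_of_isRegularEpi e (n ≫ hkn.g) fun t ht => by
    rw [← kernel.lift_ι e t ht, Category.assoc, ← Category.assoc (kernel.ι e), hkn.w, comp_zero]
  refine mono_of_cancel_zero' n' fun t ht => ?_
  -- `t` need not lift through `e`, but does so on the cover `π`.
  let π := pullback.snd e t
  let a := pullback.fst e t
  have ha : a ≫ e = π ≫ t := pullback.condition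
  obtain ⟨b, hb⟩ := NormalMono.lift' (kernel.ι e ≫ n) (a ≫ n) (by
    rw [← sq.inl_desc hkn.g v hv.symm, Category.assoc, sq.w_assoc, reassoc_of% ha, reassoc_of% ht,
      zero_comp, comp_zero])
  have hb' : b ≫ kernel.ι e = a := by rw [← cancel_mono n, Category.assoc, hb]
  have : IsRegularEpi π := inferInstanceAs (IsRegularEpi (pullback.snd e t))
  rw [← cancel_epi π, comp_zero, ← ha, ← hb', Category.assoc, kernel.condition, comp_zero]

end Protomodular

/-! ### Effective relations, direct images and cokernels -/

section BarrExact

variable {C : Type*} [Category C] [Regular C] [IsBarrExact C] [HasZeroMorphisms C]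
  [HasZeroObject C] [IsProtomodular C]

/-- In a pointed exact protomodular category, the image of a span on `X` which contains the
diagonal is the kernel pair of a regular epimorphism. -/
theorem exists_isKernelPair_image {R X : C} (ρ : R ⟶ X ⨯ X) {Y : C} (e : Y ⟶ X) [StrongEpi e]
    (δ : Y ⟶ R) (hδ : δ ≫ ρ = e ≫ diag X) :
    ∃ (S Q : C) (φ : R ⟶ S) (s₁ s₂ : S ⟶ X) (τ : X ⟶ S) (q : X ⟶ Q),
      IsRegularEpi φ ∧ IsRegularEpi q ∧ φ ≫ s₁ = ρ ≫ prod.fst ∧ φ ≫ s₂ = ρ ≫ prod.snd ∧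
        δ ≫ φ = e ≫ τ ∧ IsKernelPair q s₁ s₂ := by
  let F := Regular.strongEpiMonoFactorisation ρ
  have hF : F.e ≫ F.m = ρ := F.fac
  -- The diagonal filler shows the image relation reflexive.
  have sq : CommSq (δ ≫ F.e) e F.m (diag X) := ⟨by rw [Category.assoc, hF, hδ]⟩
  have hE := IsEquivalenceRelation.of_refl (F.m ≫ prod.fst) (F.m ≫ prod.snd)
    (fun a b h₁ h₂ => by
      rw [← cancel_mono F.m]
      apply Limits.prod.hom_ext <;> simpa using by assumption)
    sq.lift (by simp) (by simp)
  obtain ⟨Q, g, hg⟩ := IsBarrExact.effective _ _ hE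
  let G := Regular.strongEpiMonoFactorisation g
  have hG : G.e ≫ G.m = g := G.fac
  rw [← hG] at hg
  exact ⟨_, _, F.e, _, _, sq.lift, G.e, inferInstanceAs (IsRegularEpi
    (Regular.strongEpiMonoFactorisation ρ).e), inferInstanceAs (IsRegularEpi
    (Regular.strongEpiMonoFactorisation g).e), by rw [← Category.assoc, hF],
    by rw [← Category.assoc, hF], sq.fac_left.symm, hg.cancel_right_of_mono⟩

/-- Images of normal monomorphisms along regular epimorphisms are normal. -/
theorem IsNormalMono.of_image {A A' B P : C} {n : A ⟶ A'} {e : A ⟶ B} {e' : A' ⟶ P} {n' : B ⟶ P}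
    (hn : IsNormalMono n) [Epi e] [IsRegularEpi e'] [Mono n'] (w : n ≫ e' = e ≫ n') :
    IsNormalMono n' := by
  obtain ⟨hn⟩ := hn
  let h := hn.g
  have hnw : n ≫ h = 0 := hn.w
  let r₁ := pullback.fst h h
  let r₂ := pullback.snd h h
  have hr : r₁ ≫ h = r₂ ≫ h := pullback.condition
  let σ : A' ⟶ pullback h h := pullback.diagonal h
  obtain ⟨S, Q, φ, s₁, s₂, τ, g, _, _, hs₁, hs₂, hστ, hg⟩ :=
    exists_isKernelPair_image (prod.lift (r₁ ≫ e') (r₂ ≫ e')) e' σ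
      (by apply Limits.prod.hom_ext <;> simp [σ, r₁, r₂])
  rw [prod.lift_fst] at hs₁
  rw [prod.lift_snd] at hs₂
  have := isRegularEpi_pullback_lift φ e' r₂ σ (pullback.diagonal_snd h) s₂ τ hs₂.symm hστ
  have hng : n' ≫ g = 0 := by
    rw [← cancel_epi e, comp_zero, ← Category.assoc, ← w]
    let a : A ⟶ pullback h h := pullback.lift n 0 (by rw [hnw, zero_comp])
    have ha₁ : a ≫ r₁ = n := pullback.lift_fst _ _ _
    have ha₂ : a ≫ r₂ = 0 := pullback.lift_snd _ _ _
    rw [← ha₁, Category.assoc a, ← hs₁, Category.assoc, Category.assoc, hg.w, reassoc_of% hs₂,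
      reassoc_of% ha₂, zero_comp]
  refine ⟨⟨Q, g, hng, KernelFork.IsLimit.ofι' n' hng fun {T} t ht => Classical.choice ?_⟩⟩
  let l : T ⟶ S := hg.lift t 0 (by rw [ht, zero_comp])
  have hl₁ : l ≫ s₁ = t := hg.lift_fst _ _ _
  have hl₂ : l ≫ s₂ = 0 := hg.lift_snd _ _ _
  let c := pullback.lift r₂ φ hs₂.symm
  -- By the regular pushout property, `l` lifts on a cover to a pair whose second entry is exactly
  -- `0`; its first entry then lies in `n`.
  let l' : T ⟶ pullback e' s₂ := pullback.lift 0 l (by rw [hl₂, zero_comp])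
  let x := pullback.fst c l'
  let π := pullback.snd c l'
  have hx : x ≫ c = π ≫ l' := pullback.condition
  have hx₂ : x ≫ r₂ = 0 := by
    simpa [c, l', pullback.lift_fst] using hx =≫ pullback.fst e' s₂
  have hxφ : x ≫ φ = π ≫ l := by
    simpa [c, l', pullback.lift_snd] using hx =≫ pullback.snd e' s₂
  obtain ⟨y, hy⟩ := NormalMono.lift' n (x ≫ r₁) (by
    change (x ≫ r₁) ≫ h = 0
    rw [Category.assoc, hr, reassoc_of% hx₂, zero_comp])
  have sq : CommSq (y ≫ e) π n' t := ⟨by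
    rw [Category.assoc, ← w, reassoc_of% hy, ← hs₁, reassoc_of% hxφ, hl₁]⟩
  have : IsRegularEpi c := this
  have : IsRegularEpi π := inferInstanceAs (IsRegularEpi (pullback.snd c l'))
  exact ⟨⟨sq.lift, sq.fac_right⟩⟩

/-- Exact protomodular categories with binary coproducts have cokernels. -/
theorem exists_cokernel [HasBinaryCoproducts C] {X Z : C} (j : X ⟶ Z) :
    ∃ (Q : C) (q : Z ⟶ Q), Epi q ∧ j ≫ q = 0 ∧
      ∀ {W : C} (u : Z ⟶ W), j ≫ u = 0 → ∃ v : Q ⟶ W, q ≫ v = u := by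
  -- The pairs `(j, 0)` and the diagonal span a reflexive relation; its quotient identifies `j` with
  -- `0`.
  obtain ⟨S, Q, φ, s₁, s₂, τ, q, _, _, hs₁, hs₂, -, hq⟩ :=
    exists_isKernelPair_image (coprod.desc (prod.lift j 0) (diag Z)) (𝟙 Z) coprod.inr (by simp)
  refine ⟨Q, q, inferInstance, ?_, fun u hu => ?_⟩
  · have h₁ : (coprod.inl ≫ φ) ≫ s₁ = j := by rw [Category.assoc, hs₁]; simp
    have h₂ : (coprod.inl ≫ φ) ≫ s₂ = 0 := by rw [Category.assoc, hs₂]; simp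
    rw [← h₁, Category.assoc, hq.w, ← Category.assoc, h₂, zero_comp]
  · refine IsRegularEpi.exists_of_isKernelPair q hq u ?_
    rw [← cancel_epi φ, reassoc_of% hs₁, reassoc_of% hs₂]
    apply coprod.hom_ext <;> simp [hu]

/-- If pushouts of normal monomorphisms along regular epimorphisms are monomorphisms, then
normality is transitive. -/
theorem ToN.of_mono_of_isPushout [HasBinaryCoproducts C]
    (H : ∀ {A A' B P : C} (n : A ⟶ A') (e : A ⟶ B) (e' : A' ⟶ P) (n' : B ⟶ P),
      IsNormalMono n → IsRegularEpi e → IsPushout n e e' n' → Mono n') : ToN C := by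
  rintro X Y Z f g ⟨hf⟩ hg
  let F := Regular.strongEpiMonoFactorisation hf.g
  have hF : F.e ≫ F.m = hf.g := F.fac
  have : IsRegularEpi F.e := inferInstanceAs (IsRegularEpi
    (Regular.strongEpiMonoFactorisation hf.g).e)
  have hfe : f ≫ F.e = 0 := by rw [← cancel_mono F.m, Category.assoc, hF, hf.w, zero_comp]
  have hlift : ∀ {T : C} (t : T ⟶ Y), t ≫ F.e = 0 → ∃ u : T ⟶ X, u ≫ f = t := fun t ht =>
    ⟨_, (NormalMono.lift' f t (by rw [← hF, reassoc_of% ht, zero_comp])).2⟩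
  have hdesc : ∀ {W : C} (u : Y ⟶ W), f ≫ u = 0 → ∃ v, F.e ≫ v = u := fun u hu =>
    exists_desc_of_isRegularEpi F.e u fun t ht => by
      obtain ⟨x, rfl⟩ := hlift t ht
      rw [Category.assoc, hu, comp_zero]
  obtain ⟨Q, q, _, hq, hqdesc⟩ := exists_cokernel (f ≫ g)
  obtain ⟨n', hn'⟩ := hdesc (g ≫ q) (by rw [← Category.assoc, hq])
  have hs (s : PushoutCocone g F.e) : ∃ v, q ≫ v = s.inl := hqdesc s.inl (by
    rw [Category.assoc, s.condition, reassoc_of% hfe, zero_comp])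
  have sq : IsPushout g F.e q n' := ⟨⟨hn'.symm⟩, ⟨PushoutCocone.IsColimit.mk _
    (fun s => (hs s).choose)
    (fun s => (hs s).choose_spec)
    (fun s => by
      rw [← cancel_epi F.e, reassoc_of% hn', (hs s).choose_spec, s.condition])
    (fun s m hm _ => by rw [← cancel_epi q, hm, (hs s).choose_spec])⟩⟩
  have : Mono n' := H g F.e q n' hg inferInstance sq
  obtain ⟨hg⟩ := hg
  refine ⟨⟨Q, q, hq, KernelFork.IsLimit.ofι' (f ≫ g) hq fun t ht => Classical.choice ?_⟩⟩
  -- `hg.g` factors through `q`, so the kernel of `q` lies in `Y`.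
  obtain ⟨v, hv⟩ := hqdesc hg.g (by rw [Category.assoc, hg.w, comp_zero])
  obtain ⟨s, rfl⟩ := NormalMono.lift' g t (by rw [← hv, reassoc_of% ht, zero_comp])
  obtain ⟨x, rfl⟩ := hlift s (by
    rw [← cancel_mono n', Category.assoc, hn', ← Category.assoc, ht, zero_comp])
  exact ⟨⟨x, (Category.assoc _ _ _).symm⟩⟩

end BarrExact

end SemiAbelian

theorem mainTheorem12 {C : Type*} [Category C] [HasZeroMorphisms C]
    [SemiAbelian.IsSemiAbelian C] :
    (SemiAbelian.ToN C ↔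
      ∀ {A A' B P : C} (n : A ⟶ A') (e : A ⟶ B) (e' : A' ⟶ P) (n' : B ⟶ P),
        SemiAbelian.IsNormalMono n → IsRegularEpi e → IsPushout n e e' n' → Mono n') ∧
    (∀ {A A' B P : C} (n : A ⟶ A') (e : A ⟶ B) (e' : A' ⟶ P) (n' : B ⟶ P),
        SemiAbelian.IsNormalMono n → IsRegularEpi e → IsPushout n e e' n' → Mono n' →
          SemiAbelian.IsNormalMono n') := by
  have := SemiAbelian.IsSemiAbelian.hasZeroObject (C := C)
  have := SemiAbelian.IsSemiAbelian.barrExact (C := C)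
  have : Regular C := SemiAbelian.IsBarrExact.regular
  have := SemiAbelian.IsSemiAbelian.protomodular (C := C)
  have := SemiAbelian.IsSemiAbelian.hasBinaryCoproducts (C := C)
  refine ⟨⟨fun H A A' B P n e e' n' hn _ sq => H.mono_of_isPushout hn sq,
    fun H => SemiAbelian.ToN.of_mono_of_isPushout H⟩, fun n e e' n' hn _ sq _ => ?_⟩
  have := SemiAbelian.isRegularEpi_of_isPushout sq
  exact hn.of_image sq.w
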